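/- **Proposition 4.** Let $\sigma>0$, $a_s>0$, $a_t>0$, $\xi\in(-1,1)$, and let $\tilde x\in\{-1,1\}$ be a unit vector of $\mathbb{R}^1$. A function $f$ on $\mathbb{R}\times\mathbb{R}$ is called a spectral density of $C:\mathbb{R}\times\mathbb{R}\to\mathbb{R}$ if it is integrable, nonnegative, satisfies $f(-x,-\eta)=f(x,\eta)$, and $$C(h,u)=\int_{\mathbb{R}^2} e^{i(hx+u\eta)}f(x,\eta)\,dx\,d\eta\qquad\text{for all }h,u\in\mathbb{R}.$$ Consider the squared-exponential Gneiting model in spatial dimension $d=1$ with $\gamma(u)=a_t^2u^2$, $$C_0(h,u)=\frac{\sigma}{(\gamma(u)+1)^{1/2}}\exp\Big(-\frac{a_s^2h^2}{\gamma(u)+1}\Big).$$ Then $C_0$ has a spectral density of the form $\sigma f^*(|x|,|\eta|)$. For every such density, the asymmetric density $$f(x,\eta)=\sigma f^*(|x|,|\eta|)\,\{1+\xi\,\mathrm{sign}(x\tilde x)\,\mathrm{sign}(\eta)\}$$ is a spectral density of $$C(h,u)=\frac{\sigma}{\sqrt{a_t^2u^2+1}}\exp\Big(-\frac{a_s^2h^2}{a_t^2u^2+1}\Big)\Big\{1-\xi\,\tilde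 x\,\mathrm{erf}\Big(\frac{a_sh}{\sqrt{a_t^2u^2+1}}\,a_tu\Big)\Big\},$$ where $\mathrm{erf}(z)=\frac{2}{\sqrt\pi}\int_0^z e^{-t^2}\,dt$, and $C$ is a valid stationary space-time covariance function (even under $(h,u)\mapsto(-h,-u)$ and positive semidefinite). In particular, the multiplier $1-\xi\,\mathrm{sign}(x)\,\mathrm{sign}(\eta)$ (the case $\tilde x=-1$) gives $$C(h,u)=\frac{\sigma}{\sqrt{a_t^2u^2+1}}\exp\Big(-\frac{a_s^2h^2}{a_t^2u^2+1}\Big)\Big\{1+\xi\,\mathrm{erf}\Big(\frac{a_sh}{\sqrt{a_t^2u^2+1}}\,a_tu\Big)\Big\},$$ and the multiplier $1+\xi\,\mathrm{sign}(x)\,\mathrm{sign}(\eta)$ (the case $\tilde x=1$) gives the same expression with $\xi$ replaced by $-\xi$. -/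

import Mathlib

open MeasureTheory

noncomputable section

/-- The error function `erf z = (2 / √π) ∫₀ᶻ exp (-t²) dt`. -/
def erf (z : ℝ) : ℝ :=
  2 / Real.sqrt Real.pi * ∫ t in (0 : ℝ)..z, Real.exp (-t ^ 2)

/-- The (extended) Gneiting space-time model
`C(h, u) = σ (γ(u) + 1)^(-τ) φ(‖h‖² / (γ(u) + 1)^b)`. -/
def gneitingCov {E : Type*} [NormedAddCommGroup E]
    (σ τ b : ℝ) (γ φ : ℝ → ℝ) (h : E) (u : ℝ) : ℝ :=
  σ / (γ u + 1) ^ τ * φ (‖h‖ ^ 2 / (γ u + 1) ^ b)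

/-- `C` is a (stationary, real-valued) space-time covariance function: it is even under joint
reflection of the lags and positive (semi)definite. -/
structure IsSpaceTimeCovariance {E : Type*} [AddCommGroup E] (C : E → ℝ → ℝ) : Prop where
  even : ∀ h u, C (-h) (-u) = C h u
  posSemidef : ∀ (n : ℕ) (s : Fin n → E) (t : Fin n → ℝ) (c : Fin n → ℝ),
    0 ≤ ∑ i, ∑ j, c i * c j * C (s j - s i) (t j - t i)

/-- `f` is a spectral density of the space-time covariance `C`: it is integrable, nonnegative and
even under joint reflection, and
`C(h, u) = ∫ exp (i (⟨h, x⟩ + u η)) f(x, η) d(x, η)` for all lags `h`, `u`. -/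
structure IsSpectralDensity {E : Type*} [NormedAddCommGroup E] [InnerProductSpace ℝ E]
    [MeasureSpace E] (C : E → ℝ → ℝ) (f : E → ℝ → ℝ) : Prop where
  integrable : Integrable (fun p : E × ℝ => f p.1 p.2) volume
  even : ∀ x η, f (-x) (-η) = f x η
  nonneg : ∀ x η, 0 ≤ f x η
  eq_integral : ∀ h u, (C h u : ℂ) =
    ∫ p : E × ℝ,
      Complex.exp (Complex.I * ((inner ℝ h p.1 + u * p.2 : ℝ) : ℂ)) * (f p.1 p.2 : ℂ)

/-- The symmetric density `(x, η) ↦ σ f*(‖x‖, |η|)`. -/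
def symmetricDensity {E : Type*} [NormedAddCommGroup E]
    (σ : ℝ) (fStar : ℝ → ℝ → ℝ) (x : E) (η : ℝ) : ℝ :=
  σ * fStar ‖x‖ |η|

/-- The reflective asymmetric density
`(x, η) ↦ σ f*(‖x‖, |η|) {1 + ξ sign ⟨x, x̃⟩ sign η}` with direction `xt = x̃`. -/
def asymmetricDensity {E : Type*} [NormedAddCommGroup E] [InnerProductSpace ℝ E]
    (σ ξ : ℝ) (xt : E) (fStar : ℝ → ℝ → ℝ) (x : E) (η : ℝ) : ℝ :=
  symmetricDensity σ fStar x η * (1 + ξ * Real.sign (inner ℝ x xt) * Real.sign η)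

/-- The squared-exponential Gneiting model in spatial dimension one with `γ(u) = a_t² u²`,
`φ(r) = exp (-a_s² r)`, `b = 1` and `τ = 1/2`. -/
def sqExpGneitingCov (σ aS aT : ℝ) : ℝ → ℝ → ℝ :=
  gneitingCov σ (1 / 2) 1 (fun u => aT ^ 2 * u ^ 2) (fun r => Real.exp (-(aS ^ 2 * r)))

/-- The closed form
`σ (a_t² u² + 1)^(-1/2) exp (-a_s² h² / (a_t² u² + 1))
  {1 + κ erf (a_s h / √(a_t² u² + 1) · a_t u)}`. -/
def asymSqExpGneitingCov (σ aS aT κ : ℝ) (h u : ℝ) : ℝ :=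
  σ * (1 / Real.sqrt (aT ^ 2 * u ^ 2 + 1)) *
    Real.exp (-(aS ^ 2 * h ^ 2 / (aT ^ 2 * u ^ 2 + 1))) *
    (1 + κ * erf (aS * h / Real.sqrt (aT ^ 2 * u ^ 2 + 1) * (aT * u)))

end

/-! The symmetric density is explicit: writing `a`, `c` for `aS`, `aT`, it is `σ` times `exp
(-x²/(4a²) - a²η²/(c²x²)) / (2πc|x|)`. Substituting `η = x w` cancels the factor `1/|x|` and splits
it into a Gaussian in `x` times a Gaussian in `w`, while `sign x · sign η` becomes `sign w`. The
`x`-integral is then a Gaussian Fourier transform at frequency `h + u w`. What remains is a Gaussian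
in `w` against `1 + κ sign w`; completing the square moves the jump of the sign off the Gaussian's
centre, and this offset produces the erf (`integral_character_mul_sqExpGneitingDensity`).

An arbitrary density of the symmetric model agrees a.e. with the explicit one, by uniqueness of
characteristic functions (`ae_eq_of_integral_character_eq`), so the computation covers it. Validity
of `C` is the easy half of Bochner's theorem. -/

/-! ### Signs and one-dimensional Gaussian integrals -/

theorem Real.measurable_sign : Measurable Real.sign :=
  Measurable.ite measurableSet_Iio measurable_const
    (Measurable.ite measurableSet_Ioi measurable_const measurable_const)

theorem Real.abs_sign_le_one (x : ℝ) : |Real.sign x| ≤ 1 := by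
  rcases Real.sign_apply_eq x with h | h | h <;> simp [h]

theorem Real.sign_mul_of_pos {x : ℝ} (hx : 0 < x) (y : ℝ) : Real.sign (x * y) = Real.sign y := by
  rcases lt_trichotomy y 0 with hy | rfl | hy
  · rw [Real.sign_of_neg hy, Real.sign_of_neg (mul_neg_of_pos_of_neg hx hy)]
  · simp
  · rw [Real.sign_of_pos hy, Real.sign_of_pos (mul_pos hx hy)]

/-- After `η = x w` this makes the asymmetric multiplier a function of `w` alone. -/
theorem Real.sign_mul_sign_mul {x : ℝ} (hx : x ≠ 0) (y : ℝ) :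
    Real.sign x * Real.sign (x * y) = Real.sign y := by
  rcases hx.lt_or_gt with hx | hx
  · have h := Real.sign_mul_of_pos (neg_pos.2 hx) y
    rw [neg_mul, Real.sign_neg] at h
    rw [Real.sign_of_neg hx, ← h, neg_one_mul]
  · rw [Real.sign_of_pos hx, Real.sign_mul_of_pos hx, one_mul]

theorem integrable_exp_neg_sq : Integrable fun t : ℝ => Real.exp (-t ^ 2) := by
  simpa using integrable_exp_neg_mul_sq one_pos

theorem integral_Iic_exp_neg_sq (z : ℝ) :
    ∫ t in Set.Iic z, Real.exp (-t ^ 2) = Real.sqrt Real.pi / 2 * (1 + erf z) := by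
  have h0 : ∫ t in Set.Iic (0 : ℝ), Real.exp (-t ^ 2) = Real.sqrt Real.pi / 2 := by
    have h1 := integral_gaussian_Ioi 1
    have h2 := integral_comp_neg_Iic (0 : ℝ) fun t => Real.exp (-t ^ 2)
    simp only [neg_sq, neg_zero] at h2
    rw [h2]
    simpa using h1
  have h := intervalIntegral.integral_Iic_sub_Iic (a := 0) (b := z)
    integrable_exp_neg_sq.integrableOn integrable_exp_neg_sq.integrableOn
  have hpi : Real.sqrt Real.pi ≠ 0 := by positivity
  rw [erf, ← h, h0]
  field_simp
  ring

theorem integral_Ioi_exp_neg_sq (z : ℝ) :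
    ∫ t in Set.Ioi z, Real.exp (-t ^ 2) = Real.sqrt Real.pi / 2 * (1 - erf z) := by
  have h := integral_add_compl (measurableSet_Iic (a := z)) integrable_exp_neg_sq
  have ht : ∫ t : ℝ, Real.exp (-t ^ 2) = Real.sqrt Real.pi := by
    simpa using integral_gaussian 1
  rw [Set.compl_Iic, integral_Iic_exp_neg_sq, ht] at h
  linarith

theorem integral_exp_neg_sq_mul_sign (κ z : ℝ) :
    ∫ t : ℝ, Real.exp (-t ^ 2) * (1 + κ * Real.sign (t - z)) =
      Real.sqrt Real.pi * (1 - κ * erf z) := by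
  have hint : Integrable fun t : ℝ => Real.exp (-t ^ 2) * (1 + κ * Real.sign (t - z)) := by
    refine integrable_exp_neg_sq.mul_bdd (c := 1 + |κ|) ?_ (ae_of_all _ fun t => ?_)
    · exact (measurable_const.add (measurable_const.mul
        (Real.measurable_sign.comp (measurable_id.sub_const z)))).aestronglyMeasurable
    · refine (abs_add_le _ _).trans ?_
      rw [abs_one, abs_mul]
      exact add_le_add_right (mul_le_of_le_one_right (abs_nonneg _) (Real.abs_sign_le_one _)) _
  rw [← integral_add_compl (measurableSet_Iic (a := z)) hint, Set.compl_Iic]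
  have h1 : ∫ t in Set.Iic z, Real.exp (-t ^ 2) * (1 + κ * Real.sign (t - z)) =
      ∫ t in Set.Iic z, Real.exp (-t ^ 2) * (1 - κ) := by
    -- The endpoint is dropped because the sign vanishes at `t = z` instead of being `-1`.
    rw [integral_Iic_eq_integral_Iio, integral_Iic_eq_integral_Iio]
    refine setIntegral_congr_fun measurableSet_Iio fun t ht => ?_
    simp only [Real.sign_of_neg (sub_neg.2 ht)]
    ring
  have h2 : ∫ t in Set.Ioi z, Real.exp (-t ^ 2) * (1 + κ * Real.sign (t - z)) =
      ∫ t in Set.Ioi z, Real.exp (-t ^ 2) * (1 + κ) := by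
    refine setIntegral_congr_fun measurableSet_Ioi fun t ht => ?_
    simp only [Real.sign_of_pos (sub_pos.2 ht), mul_one]
  rw [h1, h2, integral_mul_const, integral_mul_const, integral_Iic_exp_neg_sq,
    integral_Ioi_exp_neg_sq]
  ring

/-- With `r² = c²u² + 1`, `m = ar/c` and `z = (ah/r)(cu)`, the exponent is `-(m w + z)² - a²h²/r²`.
Since `m > 0`, `sign w = sign (m w)`, so `t = m w + z` reduces to a centred Gaussian with its sign
jump at `z`. -/
theorem integral_gaussian_mul_sign {a c : ℝ} (ha : 0 < a) (hc : 0 < c) (h u κ : ℝ) :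
    ∫ w : ℝ, Real.exp (-(a ^ 2 * (h + u * w) ^ 2) - a ^ 2 / c ^ 2 * w ^ 2) *
        (1 + κ * Real.sign w) =
      Real.sqrt Real.pi * c / a * (1 / Real.sqrt (c ^ 2 * u ^ 2 + 1) *
        Real.exp (-(a ^ 2 * h ^ 2 / (c ^ 2 * u ^ 2 + 1))) *
        (1 - κ * erf (a * h / Real.sqrt (c ^ 2 * u ^ 2 + 1) * (c * u)))) := by
  have hs : 0 < c ^ 2 * u ^ 2 + 1 := by positivity
  set r := Real.sqrt (c ^ 2 * u ^ 2 + 1) with hr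
  have hr0 : 0 < r := Real.sqrt_pos.2 hs
  have hr2 : r ^ 2 = c ^ 2 * u ^ 2 + 1 := Real.sq_sqrt hs.le
  rw [← hr2]
  set z := a * h / r * (c * u) with hz
  set m := a * r / c with hm
  have hm0 : 0 < m := by positivity
  have key : ∀ w : ℝ, Real.exp (-(a ^ 2 * (h + u * w) ^ 2) - a ^ 2 / c ^ 2 * w ^ 2) *
        (1 + κ * Real.sign w) = Real.exp (-(a ^ 2 * h ^ 2 / r ^ 2)) *
        (Real.exp (-(m * w + z) ^ 2) * (1 + κ * Real.sign ((m * w + z) - z))) := by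
    intro w
    rw [add_sub_cancel_right, Real.sign_mul_of_pos hm0, ← mul_assoc, ← Real.exp_add]
    congr 2
    have e : (m * w + z) ^ 2 = (a * (r ^ 2 * w + c ^ 2 * u * h)) ^ 2 / (c ^ 2 * r ^ 2) := by
      rw [hm, hz]; field_simp
    rw [e]
    field_simp
    rw [hr2]
    ring
  simp_rw [key]
  rw [integral_const_mul, Measure.integral_comp_mul_left
    (fun y => Real.exp (-(y + z) ^ 2) * (1 + κ * Real.sign ((y + z) - z))) m,
    integral_add_right_eq_self (fun y => Real.exp (-y ^ 2) * (1 + κ * Real.sign (y - z))) z,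
    integral_exp_neg_sq_mul_sign, abs_of_pos (inv_pos.2 hm0), hm, smul_eq_mul]
  field_simp

theorem integral_cexp_mul_gaussian {a : ℝ} (ha : 0 < a) (t : ℝ) :
    ∫ x : ℝ, Complex.exp (Complex.I * t * x) * (Real.exp (-(x ^ 2 / (4 * a ^ 2))) : ℂ) =
      ((2 * a * Real.sqrt Real.pi * Real.exp (-(a ^ 2 * t ^ 2)) : ℝ) : ℂ) := by
  have hb : 0 < ((1 / (4 * a ^ 2) : ℝ) : ℂ).re := by
    rw [Complex.ofReal_re]; positivity
  have h := fourierIntegral_gaussian hb t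
  have e : (Real.pi / ((1 / (4 * a ^ 2) : ℝ) : ℂ)) ^ (1 / 2 : ℂ) =
      ((2 * a * Real.sqrt Real.pi : ℝ) : ℂ) := by
    have h2 : 2 * a * Real.sqrt Real.pi = (Real.pi / (1 / (4 * a ^ 2))) ^ (1 / 2 : ℝ) := by
      rw [← Real.sqrt_eq_rpow, show Real.pi / (1 / (4 * a ^ 2)) = (2 * a) ^ 2 * Real.pi by
        field_simp; norm_num, Real.sqrt_mul (by positivity), Real.sqrt_sq (by positivity)]
    rw [h2, Complex.ofReal_cpow (by positivity)]
    push_cast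
    rfl
  rw [e] at h
  have e2 : -(t : ℂ) ^ 2 / (4 * ((1 / (4 * a ^ 2) : ℝ) : ℂ)) = ((-(a ^ 2 * t ^ 2) : ℝ) : ℂ) := by
    have : (a : ℂ) ≠ 0 := by exact_mod_cast ha.ne'
    push_cast
    field_simp
  rw [e2, ← Complex.ofReal_exp, ← Complex.ofReal_mul] at h
  rw [← h]
  refine integral_congr_ae (ae_of_all _ fun x => ?_)
  simp only [Complex.ofReal_exp]
  congr 2
  push_cast
  ring

/-- The normalized spectral density of the squared-exponential Gneiting model. -/
noncomputable def sqExpGneitingDensity (a c x η : ℝ) : ℝ :=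
  1 / (2 * Real.pi * c * |x|) * Real.exp (-(x ^ 2 / (4 * a ^ 2)) - a ^ 2 / (c ^ 2 * x ^ 2) * η ^ 2)

/-! ### The explicit density and its Fourier transform -/

theorem measurable_sqExpGneitingDensity (a c : ℝ) :
    Measurable fun p : ℝ × ℝ => sqExpGneitingDensity a c p.1 p.2 := by
  unfold sqExpGneitingDensity
  fun_prop

theorem sqExpGneitingDensity_nonneg {a c : ℝ} (hc : 0 < c) (x η : ℝ) :
    0 ≤ sqExpGneitingDensity a c x η := by
  unfold sqExpGneitingDensity
  positivity

/-- By Tonelli: the `η`-integral is proportional to `|x|`, which cancels the singular prefactor and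
leaves a Gaussian in `x`. -/
theorem integrable_sqExpGneitingDensity {a c : ℝ} (ha : 0 < a) (hc : 0 < c) :
    Integrable (fun p : ℝ × ℝ => sqExpGneitingDensity a c p.1 p.2) volume := by
  have hform : ∀ x η : ℝ, sqExpGneitingDensity a c x η = 1 / (2 * Real.pi * c * |x|) *
      Real.exp (-(x ^ 2 / (4 * a ^ 2))) * Real.exp (-(a ^ 2 / (c ^ 2 * x ^ 2)) * η ^ 2) := by
    intro x η
    rw [sqExpGneitingDensity, mul_assoc (1 / (2 * Real.pi * c * |x|)), ← Real.exp_add]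
    ring_nf
  have hne : ∀ᵐ x : ℝ, x ≠ 0 := Measure.ae_ne volume 0
  rw [Measure.volume_eq_prod,
    integrable_prod_iff (measurable_sqExpGneitingDensity a c).aestronglyMeasurable]
  refine ⟨?_, ?_⟩
  · filter_upwards [hne] with x hx
    simp only [hform]
    exact (integrable_exp_neg_mul_sq (by positivity)).const_mul _
  · have hg : Integrable (fun x : ℝ => 1 / (2 * Real.sqrt Real.pi * a) *
        Real.exp (-(1 / (4 * a ^ 2)) * x ^ 2)) :=
      (integrable_exp_neg_mul_sq (by positivity)).const_mul _
    refine hg.congr ?_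
    filter_upwards [hne] with x hx
    have hx' : 0 < |x| := abs_pos.2 hx
    simp_rw [Real.norm_of_nonneg (sqExpGneitingDensity_nonneg hc _ _), hform]
    rw [integral_const_mul, integral_gaussian,
      show Real.pi / (a ^ 2 / (c ^ 2 * x ^ 2)) = (c * |x| / a) ^ 2 * Real.pi by
        rw [div_pow, mul_pow, sq_abs]; field_simp,
      Real.sqrt_mul (by positivity), Real.sqrt_sq (by positivity),
      show -(1 / (4 * a ^ 2)) * x ^ 2 = -(x ^ 2 / (4 * a ^ 2)) by ring]
    have hpi : Real.sqrt Real.pi ≠ 0 := by positivity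
    have hpi2 : Real.sqrt Real.pi ^ 2 = Real.pi := Real.sq_sqrt Real.pi_pos.le
    rw [← hpi2, Real.sqrt_sq (Real.sqrt_nonneg _)]
    field_simp

theorem integrable_mul_one_add_sign {f : ℝ × ℝ → ℝ} (hf : Integrable f) (κ : ℝ) :
    Integrable fun p : ℝ × ℝ => f p * (1 + κ * Real.sign p.1 * Real.sign p.2) := by
  refine hf.mul_bdd (c := 1 + |κ|) ?_ (ae_of_all _ fun p => ?_)
  · exact (measurable_const.add ((measurable_const.mul
      (Real.measurable_sign.comp measurable_fst)).mul
      (Real.measurable_sign.comp measurable_snd))).aestronglyMeasurable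
  · refine (abs_add_le _ _).trans ?_
    rw [abs_one, abs_mul, abs_mul]
    refine add_le_add_right ?_ _
    calc |κ| * |Real.sign p.1| * |Real.sign p.2| ≤ |κ| * 1 * 1 := by
          gcongr <;> exact Real.abs_sign_le_one _
      _ = |κ| := by ring

theorem integrable_character_mul {f : ℝ × ℝ → ℝ} (hf : Integrable f) (h u : ℝ) :
    Integrable fun p : ℝ × ℝ =>
      Complex.exp (Complex.I * ((h * p.1 + u * p.2 : ℝ) : ℂ)) * (f p : ℂ) := by
  refine hf.ofReal.bdd_mul (c := 1) ?_ (ae_of_all _ fun p => ?_)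
  · exact Continuous.aestronglyMeasurable (by fun_prop)
  · rw [mul_comm, Complex.norm_exp_ofReal_mul_I]

theorem integral_character_mul_sqExpGneitingDensity {a c : ℝ} (ha : 0 < a) (hc : 0 < c)
    (κ h u : ℝ) :
    ∫ p : ℝ × ℝ, Complex.exp (Complex.I * ((h * p.1 + u * p.2 : ℝ) : ℂ)) *
        ((sqExpGneitingDensity a c p.1 p.2 * (1 + κ * Real.sign p.1 * Real.sign p.2) : ℝ) : ℂ) =
      ((1 / Real.sqrt (c ^ 2 * u ^ 2 + 1) *
        Real.exp (-(a ^ 2 * h ^ 2 / (c ^ 2 * u ^ 2 + 1))) *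
        (1 - κ * erf (a * h / Real.sqrt (c ^ 2 * u ^ 2 + 1) * (c * u))) : ℝ) : ℂ) := by
  set W : ℝ → ℝ := fun w =>
    1 / (2 * Real.pi * c) * (Real.exp (-(a ^ 2 / c ^ 2) * w ^ 2) * (1 + κ * Real.sign w)) with hW
  set G : ℝ → ℝ := fun x => Real.exp (-(x ^ 2 / (4 * a ^ 2))) with hG
  have hGint : Integrable G := by
    have := integrable_exp_neg_mul_sq (b := 1 / (4 * a ^ 2)) (by positivity)
    refine this.congr (ae_of_all _ fun x => ?_)
    simp only [hG]
    ring_nf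
  have hWint : Integrable W := by
    refine Integrable.const_mul ?_ _
    refine (integrable_exp_neg_mul_sq (by positivity)).mul_bdd (c := 1 + |κ|) ?_
      (ae_of_all _ fun t => ?_)
    · exact (measurable_const.add
        (measurable_const.mul Real.measurable_sign)).aestronglyMeasurable
    · refine (abs_add_le _ _).trans ?_
      rw [abs_one, abs_mul]
      exact add_le_add_right (mul_le_of_le_one_right (abs_nonneg _) (Real.abs_sign_le_one _)) _
  have hint := integrable_character_mul
    (integrable_mul_one_add_sign (integrable_sqExpGneitingDensity ha hc) κ) h u
  rw [Measure.volume_eq_prod] at hint ⊢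
  rw [integral_prod _ hint]
  have hsub : ∫ x : ℝ, ∫ η : ℝ, Complex.exp (Complex.I * ((h * x + u * η : ℝ) : ℂ)) *
        ((sqExpGneitingDensity a c x η * (1 + κ * Real.sign x * Real.sign η) : ℝ) : ℂ) =
      ∫ x : ℝ, ∫ w : ℝ, Complex.exp (Complex.I * (((h + u * w) * x : ℝ) : ℂ)) *
        ((G x * W w : ℝ) : ℂ) := by
    refine integral_congr_ae ?_
    filter_upwards [Measure.ae_ne volume (0 : ℝ)] with x hx
    have hx' : 0 < |x| := abs_pos.2 hx
    -- The substitution `η = x w`, valid for `x ≠ 0`; its Jacobian `|x|` absorbs the prefactor of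
    -- the density.
    have hcv := Measure.integral_comp_mul_left (fun η : ℝ =>
      Complex.exp (Complex.I * ((h * x + u * η : ℝ) : ℂ)) *
        ((sqExpGneitingDensity a c x η * (1 + κ * Real.sign x * Real.sign η) : ℝ) : ℂ)) x
    have hcv' := congrArg (fun y : ℂ => |x| • y) hcv
    simp only [smul_smul, abs_inv, mul_inv_cancel₀ hx'.ne', one_smul] at hcv'
    rw [← hcv', ← integral_smul]
    refine integral_congr_ae (ae_of_all _ fun w => ?_)
    simp only [Complex.real_smul]
    rw [mul_left_comm, ← Complex.ofReal_mul]
    congr 2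
    · congr 2; ring
    · rw [mul_assoc κ, Real.sign_mul_sign_mul hx, hG, hW, sqExpGneitingDensity, sub_eq_add_neg,
        Real.exp_add, show -(a ^ 2 / (c ^ 2 * x ^ 2) * (x * w) ^ 2) = -(a ^ 2 / c ^ 2) * w ^ 2 by
          field_simp]
      field_simp
  rw [hsub, integral_integral_swap]
  · have hin : ∀ w : ℝ, ∫ x : ℝ, Complex.exp (Complex.I * (((h + u * w) * x : ℝ) : ℂ)) *
        ((G x * W w : ℝ) : ℂ) =
        ((2 * a * Real.sqrt Real.pi * Real.exp (-(a ^ 2 * (h + u * w) ^ 2)) * W w : ℝ) : ℂ) := by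
      intro w
      rw [Complex.ofReal_mul _ (W w), ← integral_cexp_mul_gaussian ha, ← integral_mul_const]
      refine integral_congr_ae (ae_of_all _ fun x => ?_)
      simp only [hG]
      push_cast
      ring_nf
    simp_rw [hin]
    rw [integral_complex_ofReal]
    congr 1
    have hf : ∀ w : ℝ, 2 * a * Real.sqrt Real.pi * Real.exp (-(a ^ 2 * (h + u * w) ^ 2)) * W w =
        a * Real.sqrt Real.pi / (Real.pi * c) *
        (Real.exp (-(a ^ 2 * (h + u * w) ^ 2) - a ^ 2 / c ^ 2 * w ^ 2) *
          (1 + κ * Real.sign w)) := by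
      intro w
      simp only [sub_eq_add_neg, Real.exp_add, hW, neg_mul]
      field_simp
    simp_rw [hf]
    rw [integral_const_mul, integral_gaussian_mul_sign ha hc, ← mul_assoc]
    have hpi2 : Real.sqrt Real.pi ^ 2 = Real.pi := Real.sq_sqrt Real.pi_pos.le
    have : a * Real.sqrt Real.pi / (Real.pi * c) * (Real.sqrt Real.pi * c / a) = 1 := by
      field_simp
      rw [hpi2]
    rw [this, one_mul]
  · refine ((hGint.mul_prod hWint).ofReal (𝕜 := ℂ)).bdd_mul (c := 1) ?_ (ae_of_all _ fun p => ?_)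
    · exact Continuous.aestronglyMeasurable (by fun_prop)
    · rw [mul_comm, Complex.norm_exp_ofReal_mul_I]

theorem Real.inner_eq_mul (x y : ℝ) : inner ℝ x y = x * y := by
  simp [mul_comm]

/-! ### Uniqueness of densities and positive semidefiniteness -/

theorem ae_eq_of_integral_character_eq {f g : ℝ × ℝ → ℝ} (hf : Integrable f) (hg : Integrable g)
    (hf0 : ∀ p, 0 ≤ f p) (hg0 : ∀ p, 0 ≤ g p)
    (hfg : ∀ h u : ℝ,
      ∫ p : ℝ × ℝ, Complex.exp (Complex.I * ((h * p.1 + u * p.2 : ℝ) : ℂ)) * (f p : ℂ) =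
      ∫ p : ℝ × ℝ, Complex.exp (Complex.I * ((h * p.1 + u * p.2 : ℝ) : ℂ)) * (g p : ℂ)) :
    f =ᵐ[volume] g := by
  have := isFiniteMeasure_withDensity_ofReal hf.2
  have := isFiniteMeasure_withDensity_ofReal hg.2
  have hchar : ∀ {k : ℝ × ℝ → ℝ}, Integrable k → (∀ p, 0 ≤ k p) →
      ∀ L : StrongDual ℝ (ℝ × ℝ),
      charFunDual (volume.withDensity fun p => ENNReal.ofReal (k p)) L =
      ∫ p : ℝ × ℝ, Complex.exp
        (Complex.I * ((L (1, 0) * p.1 + L (0, 1) * p.2 : ℝ) : ℂ)) * (k p : ℂ) := by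
    intro k hk hk0 L
    rw [charFunDual_apply, integral_withDensity_eq_integral_toReal_smul₀
      hk.aemeasurable.ennreal_ofReal (ae_of_all _ fun _ => ENNReal.ofReal_lt_top)]
    refine integral_congr_ae (ae_of_all _ fun p => ?_)
    -- Every functional on the plane is a frequency pair `(h, u)`, so the hypothesis determines the
    -- whole characteristic function.
    have hL : L p = L (1, 0) * p.1 + L (0, 1) * p.2 := by
      have : p = p.1 • ((1, 0) : ℝ × ℝ) + p.2 • ((0, 1) : ℝ × ℝ) := by
        ext <;> simp
      conv_lhs => rw [this]
      simp only [map_add, map_smul, smul_eq_mul]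
      ring
    simp only [ENNReal.toReal_ofReal (hk0 p), Complex.real_smul, hL]
    rw [mul_comm, mul_comm Complex.I]
  have hmeas : (volume.withDensity fun p => ENNReal.ofReal (f p)) =
      volume.withDensity fun p => ENNReal.ofReal (g p) := by
    refine Measure.ext_of_charFunDual (funext fun L => ?_)
    rw [hchar hf hf0, hchar hg hg0, hfg]
  have hae := (withDensity_eq_iff hf.aemeasurable.ennreal_ofReal hg.aemeasurable.ennreal_ofReal
    (by rw [← ofReal_integral_eq_lintegral_ofReal hf (ae_of_all _ hf0)]
        exact ENNReal.ofReal_ne_top)).1 hmeas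
  filter_upwards [hae] with p hp
  exact (ENNReal.ofReal_eq_ofReal_iff (hf0 p) (hg0 p)).1 hp

theorem IsSpectralDensity.isSpaceTimeCovariance {C f : ℝ → ℝ → ℝ} (hC : IsSpectralDensity C f) :
    IsSpaceTimeCovariance C := by
  have heq : ∀ h u, (C h u : ℂ) = ∫ p : ℝ × ℝ,
      Complex.exp (Complex.I * ((h * p.1 + u * p.2 : ℝ) : ℂ)) * (f p.1 p.2 : ℂ) := by
    intro h u
    rw [hC.eq_integral]
    simp only [Real.inner_eq_mul]
  refine ⟨fun h u => ?_, fun n s t c => ?_⟩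
  · apply Complex.ofReal_injective
    rw [heq, heq, ← integral_neg_eq_self]
    refine integral_congr_ae (ae_of_all _ fun p => ?_)
    simp only [Prod.fst_neg, Prod.snd_neg, hC.even, neg_mul_neg]
  · set S : ℝ × ℝ → ℂ := fun p =>
      ∑ j, (c j : ℂ) * Complex.exp (Complex.I * ((s j * p.1 + t j * p.2 : ℝ) : ℂ)) with hS
    have key : ((∑ i, ∑ j, c i * c j * C (s j - s i) (t j - t i) : ℝ) : ℂ) =
        ((∫ p : ℝ × ℝ, Complex.normSq (S p) * f p.1 p.2 : ℝ) : ℂ) := by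
      have hi : ∀ i j, Integrable fun p : ℝ × ℝ => ((c i * c j : ℝ) : ℂ) *
          (Complex.exp (Complex.I * (((s j - s i) * p.1 + (t j - t i) * p.2 : ℝ) : ℂ)) *
            (f p.1 p.2 : ℂ)) := fun i j =>
        (integrable_character_mul hC.integrable _ _).const_mul _
      push_cast
      simp_rw [heq, ← Complex.ofReal_mul, ← integral_const_mul]
      rw [← integral_complex_ofReal]
      simp_rw [← integral_finsetSum _ fun j _ => hi _ j]
      rw [← integral_finsetSum _ fun i _ => integrable_finsetSum _ fun j _ => hi i j]
      refine integral_congr_ae (ae_of_all _ fun p => ?_)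
      simp only
      rw [Complex.ofReal_mul, Complex.normSq_eq_conj_mul_self, hS]
      simp only [map_sum]
      rw [Finset.sum_mul_sum]
      simp only [Finset.sum_mul]
      refine Finset.sum_congr rfl fun i _ => Finset.sum_congr rfl fun j _ => ?_
      simp only [map_mul, Complex.conj_ofReal, ← Complex.exp_conj, Complex.conj_I]
      rw [mul_mul_mul_comm, ← Complex.exp_add, ← Complex.ofReal_mul, mul_assoc]
      congr 3
      push_cast
      ring
    rw [Complex.ofReal_injective key]
    exact integral_nonneg fun p => mul_nonneg (Complex.normSq_nonneg _) (hC.nonneg _ _)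

/-! ### Symmetric and asymmetric Gneiting models -/

theorem sqExpGneitingCov_eq (σ aS aT : ℝ) :
    sqExpGneitingCov σ aS aT = asymSqExpGneitingCov σ aS aT 0 := by
  funext h u
  simp only [sqExpGneitingCov, gneitingCov, asymSqExpGneitingCov, Real.rpow_one,
    Real.norm_eq_abs, sq_abs, zero_mul, add_zero, mul_one, ← Real.sqrt_eq_rpow]
  ring_nf

theorem isSpectralDensity_sqExpGneitingDensity {σ aS aT : ℝ} (hσ : 0 < σ) (haS : 0 < aS)
    (haT : 0 < aT) :
    IsSpectralDensity (sqExpGneitingCov σ aS aT)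
      (symmetricDensity σ (sqExpGneitingDensity aS aT)) := by
  have habs : ∀ x η : ℝ, symmetricDensity σ (sqExpGneitingDensity aS aT) x η =
      σ * sqExpGneitingDensity aS aT x η := fun x η => by
    simp [symmetricDensity, sqExpGneitingDensity]
  refine ⟨?_, fun x η => ?_, fun x η => ?_, fun h u => ?_⟩
  · simp only [habs]
    exact (integrable_sqExpGneitingDensity haS haT).const_mul σ
  · simp [symmetricDensity]
  · rw [habs]
    exact mul_nonneg hσ.le (sqExpGneitingDensity_nonneg haT _ _)
  -- The symmetric model is the case `κ = 0`.
  · have h0 := integral_character_mul_sqExpGneitingDensity haS haT 0 h u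
    simp only [zero_mul, add_zero, mul_one, sub_zero] at h0
    have hint : ∀ p : ℝ × ℝ, Complex.exp (Complex.I * ((inner ℝ h p.1 + u * p.2 : ℝ) : ℂ)) *
        (symmetricDensity σ (sqExpGneitingDensity aS aT) p.1 p.2 : ℂ) =
        (σ : ℂ) * (Complex.exp (Complex.I * ((h * p.1 + u * p.2 : ℝ) : ℂ)) *
          (sqExpGneitingDensity aS aT p.1 p.2 : ℂ)) := fun p => by
      rw [habs, Real.inner_eq_mul, Complex.ofReal_mul σ, mul_left_comm]
    simp_rw [hint]
    rw [integral_const_mul, h0, sqExpGneitingCov_eq, ← Complex.ofReal_mul]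
    simp [asymSqExpGneitingCov, mul_assoc]

theorem symmetricDensity_ae_eq {σ aS aT : ℝ} (hσ : 0 < σ) (haS : 0 < aS) (haT : 0 < aT)
    {fStar : ℝ → ℝ → ℝ}
    (hf : IsSpectralDensity (sqExpGneitingCov σ aS aT) (symmetricDensity σ fStar)) :
    (fun p : ℝ × ℝ => symmetricDensity σ fStar p.1 p.2) =ᵐ[volume]
      fun p => σ * sqExpGneitingDensity aS aT p.1 p.2 := by
  have hg := isSpectralDensity_sqExpGneitingDensity hσ haS haT
  have h := ae_eq_of_integral_character_eq hf.integrable hg.integrable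
    (fun p => hf.nonneg _ _) (fun p => hg.nonneg _ _) fun h u => by
      have h1 := (hf.eq_integral h u).symm.trans (hg.eq_integral h u)
      simpa only [Real.inner_eq_mul] using h1
  filter_upwards [h] with p hp
  rw [hp]
  simp [symmetricDensity, sqExpGneitingDensity]

theorem isSpectralDensity_asymmetricDensity {σ aS aT ξ xt : ℝ} (hσ : 0 < σ) (haS : 0 < aS)
    (haT : 0 < aT) (hξ : |ξ| ≤ 1) (hxt : ‖xt‖ = 1) {fStar : ℝ → ℝ → ℝ}
    (hf : IsSpectralDensity (sqExpGneitingCov σ aS aT) (symmetricDensity σ fStar)) :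
    IsSpectralDensity (asymSqExpGneitingCov σ aS aT (-(ξ * xt)))
      (asymmetricDensity σ ξ xt fStar) := by
  -- A unit vector of the line is `±1`, so the direction only rescales `ξ` to `κ = ξ xt`.
  have hsign : ∀ x : ℝ, Real.sign (inner ℝ x xt) = xt * Real.sign x := fun x => by
    rw [Real.inner_eq_mul]
    rcases eq_or_eq_neg_of_abs_eq hxt with rfl | rfl
    · simp
    · simp [Real.sign_neg]
  have hform : ∀ x η : ℝ, asymmetricDensity σ ξ xt fStar x η =
      symmetricDensity σ fStar x η * (1 + ξ * xt * Real.sign x * Real.sign η) := fun x η => by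
    rw [asymmetricDensity, hsign]
    ring
  refine ⟨?_, fun x η => ?_, fun x η => ?_, fun h u => ?_⟩
  · simp only [hform]
    exact integrable_mul_one_add_sign hf.integrable _
  · simp only [hform, hf.even, Real.sign_neg]
    ring
  · rw [hform]
    refine mul_nonneg (hf.nonneg x η) ?_
    have hb : |ξ * xt * Real.sign x * Real.sign η| ≤ 1 := by
      rw [abs_mul, abs_mul, abs_mul, show |xt| = 1 from hxt]
      calc |ξ| * 1 * |Real.sign x| * |Real.sign η| ≤ 1 * 1 * 1 * 1 := by
            gcongr <;> exact Real.abs_sign_le_one _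
        _ = 1 := by norm_num
    linarith [neg_le_of_abs_le hb]
  · have h0 := integral_character_mul_sqExpGneitingDensity haS haT (ξ * xt) h u
    -- Only a.e. equality is available for a general `fStar`, and it suffices under the integral.
    have hae := symmetricDensity_ae_eq hσ haS haT hf
    have h1 : ∫ p : ℝ × ℝ, Complex.exp (Complex.I * ((inner ℝ h p.1 + u * p.2 : ℝ) : ℂ)) *
          (asymmetricDensity σ ξ xt fStar p.1 p.2 : ℂ) =
        ∫ p : ℝ × ℝ, (σ : ℂ) * (Complex.exp (Complex.I * ((h * p.1 + u * p.2 : ℝ) : ℂ)) *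
          ((sqExpGneitingDensity aS aT p.1 p.2 *
            (1 + ξ * xt * Real.sign p.1 * Real.sign p.2) : ℝ) : ℂ)) := by
      refine integral_congr_ae ?_
      filter_upwards [hae] with p hp
      rw [hform, hp, Real.inner_eq_mul, mul_left_comm, ← Complex.ofReal_mul, mul_assoc σ]
    rw [h1, integral_const_mul, h0, ← Complex.ofReal_mul, asymSqExpGneitingCov]
    congr 1
    ring

theorem proposition4 (σ aS aT ξ xt : ℝ) (hσ : 0 < σ) (haS : 0 < aS) (haT : 0 < aT)
    (hξ : ξ ∈ Set.Ioo (-1 : ℝ) 1) (hxt : ‖xt‖ = 1) :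
    (∃ fStar : ℝ → ℝ → ℝ,
      IsSpectralDensity (sqExpGneitingCov σ aS aT) (symmetricDensity σ fStar)) ∧
    (∀ fStar : ℝ → ℝ → ℝ,
      IsSpectralDensity (sqExpGneitingCov σ aS aT) (symmetricDensity σ fStar) →
      IsSpectralDensity (asymSqExpGneitingCov σ aS aT (-(ξ * xt)))
        (asymmetricDensity σ ξ xt fStar)) ∧
    IsSpaceTimeCovariance (asymSqExpGneitingCov σ aS aT (-(ξ * xt))) := by
  have hξ' : |ξ| ≤ 1 := (abs_lt.2 hξ).le
  have h0 := isSpectralDensity_sqExpGneitingDensity hσ haS haT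
  exact ⟨⟨_, h0⟩, fun _ hf => isSpectralDensity_asymmetricDensity hσ haS haT hξ' hxt hf,
    (isSpectralDensity_asymmetricDensity hσ haS haT hξ' hxt h0).isSpaceTimeCovariance⟩
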